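/- An ideal on $\omega=\{0,1,2,\dots\}$ is a family $\mathcal I$ of subsets of $\omega$ that is closed under subsets and finite unions, contains the family $\mathrm{Fin}$ of all finite subsets of $\omega$, and satisfies $\omega\notin\mathcal I$. For a bounded real sequence $x=(x_n)_{n\in\omega}$ let $$\mathrm{core}_x(\mathcal I)=\bigcap_{S\subseteq\omega,\ \omega\setminus S\in\mathcal I}\overline{\mathrm{co}}\,\{x_n:n\in S\},$$ where $\overline{\mathrm{co}}$ denotes the closed convex hull. Let $(\ell_\infty,\ell_\infty)$ be the set of infinite real matrices $A=(a_{n,k})_{n,k\in\omega}$ such that for every bounded real sequence $x$ all the series $A_nx=\sum_{k}a_{n,k}x_k$, $n \in \omega$, converge and the sequence $Ax=(A_nx)_{n\in\omega}$ is bounded. Let $\mathrm{Fin}\oplus\mathcal P(\omega)$ be the family of all $S\subseteq\{0,1\}\times\omega$ such that $S\cap(\{0\}\times\omega)$ is finite; an ideal $\mathcal I$ on $\omega$ is an isomorphic copy of it if there is a bijection $f:\omega\to\{0,1\}\times\omega$ such that, for every $S\subseteq\{0,1\}\times\omega$, $S\in\mathrm{Fin}\oplus\mathcal P(\omega)$ if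 and only if $f^{-1}[S]\in\mathcal I$. Theorem. Let $\mathcal I$ be an ideal on $\omega$. There is a matrix $A\in(\ell_\infty,\ell_\infty)$ such that $\mathrm{core}_{Ax}(\mathrm{Fin})=\mathrm{core}_x(\mathcal I)$ for all bounded real sequences $x$ if and only if $\mathcal I=\mathrm{Fin}$ or $\mathcal I$ is an isomorphic copy of $\mathrm{Fin}\oplus\mathcal P(\omega)$. Moreover, the latter condition holds if and only if there is an infinite set $T\subseteq\omega$ such that $\mathcal I=\{S\subseteq\omega:S\cap T\text{ is finite}\}$. -/

import Mathlib

open Filter Topology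

namespace IdealCore

/-- An ideal on `ω` (a Mathlib order ideal of `Set ℕ`: nonempty, closed under subsets and finite
unions) satisfying the usual conventions: it contains all finite sets and does not contain `ω`. -/
structure Admissible (I : Order.Ideal (Set ℕ)) : Prop where
  finite_mem : ∀ S : Set ℕ, S.Finite → S ∈ I
  univ_notMem : (Set.univ : Set ℕ) ∉ I

/-- The ideal `Fin` of finite subsets of `ω`. -/
def finIdeal : Order.Ideal (Set ℕ) where
  carrier := {S | S.Finite}
  lower' := fun _ _ hTS hS => Set.Finite.subset hS hTS
  nonempty' := ⟨∅, Set.finite_empty⟩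
  directed' := fun S hS T hT =>
    ⟨S ∪ T, Set.Finite.union hS hT, Set.subset_union_left, Set.subset_union_right⟩

/-- The ideal `Fin ⊕ P(ω)` on `{0,1} × ω`: the sets with finite trace on `{0} × ω`. -/
def finSumPowerset : Order.Ideal (Set (Fin 2 × ℕ)) where
  carrier := {S | (S ∩ ({0} ×ˢ Set.univ)).Finite}
  lower' := fun _ _ hTS hS => Set.Finite.subset hS (Set.inter_subset_inter_left _ hTS)
  nonempty' := ⟨∅, by simp⟩
  directed' := fun S hS T hT =>
    ⟨S ∪ T, by
      have h : ((S ∩ ({0} ×ˢ Set.univ)) ∪ (T ∩ ({0} ×ˢ Set.univ))).Finite :=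
        Set.Finite.union hS hT
      simpa only [Set.mem_ofPred_eq, Set.union_inter_distrib_right] using h,
      Set.subset_union_left, Set.subset_union_right⟩

/-- `I` is an isomorphic copy of `J`: a bijection of the underlying sets carries one ideal to
the other. -/
def IsIsomorphicCopy {α β : Type*} (I : Order.Ideal (Set α)) (J : Order.Ideal (Set β)) : Prop :=
  ∃ f : α ≃ β, ∀ S : Set β, S ∈ J ↔ f ⁻¹' S ∈ I

/-- The `I`-core of a real sequence: the intersection of the closed convex hulls of
`{x n : n ∈ S}` over all `S` in the dual filter of `I`. -/
def core (I : Order.Ideal (Set ℕ)) (x : ℕ → ℝ) : Set ℝ :=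
  ⋂ S ∈ {S : Set ℕ | Sᶜ ∈ I}, closure (convexHull ℝ (x '' S))

/-- The domain of an infinite matrix: the real sequences `x` for which every series
`∑ k, A n k * x k` converges, as a limit of partial sums. -/
def dom (A : Matrix ℕ ℕ ℝ) : Set (ℕ → ℝ) :=
  {x | ∀ n, ∃ y : ℝ, Tendsto (fun N => ∑ k ∈ Finset.range N, A n k * x k) atTop (𝓝 y)}

/-- The transformed sequence `A x`, with `n`-th term `∑ k, A n k * x k` (limit of partial sums);
meaningful for `x ∈ dom A`. -/
noncomputable def transform (A : Matrix ℕ ℕ ℝ) (x : ℕ → ℝ) : ℕ → ℝ :=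
  fun n => limUnder atTop (fun N => ∑ k ∈ Finset.range N, A n k * x k)

/-- The class `(X, Y)` of matrices that are defined on `X` and map `X` into `Y`. -/
def matrixClass (X Y : Set (ℕ → ℝ)) : Set (Matrix ℕ ℕ ℝ) :=
  {A | X ⊆ dom A ∧ ∀ x ∈ X, transform A x ∈ Y}

/-- The bounded real sequences `ℓ∞`. -/
def ellInfty : Set (ℕ → ℝ) := {x | ∃ C : ℝ, ∀ n, |x n| ≤ C}

end IdealCore

open IdealCore

namespace IdealCore

/-! Only indicator sequences are needed to recover the ideal. Write `r n E` for the sum of row `n`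
over `E`. If `E ∈ I`, the core of the indicator lies in `{0}`, so `r n E → 0`; if `E ∉ I`, the core
contains `1`, so `r n E` exceeds each `d < 1` infinitely often. No set may fall between these
alternatives.

Let `T` be the set of columns with an entry above `1 / 2`. Two gliding humps (`exists_gliding_hump`)
show that `I` consists of the sets with finite trace on `T`. Infinitely many columns of `T` contain
a sparse subset whose row sums do not tend to `0` (`notMem_of_infinite`). Off `T`, a set outside `I`
would yield a union of finite blocks with row sums eventually at most `7 / 8` but infinitely often
at least `1 / 8` (`mem_of_entries_le_half`).

Conversely, composition with an enumeration of `T` is given by a matrix and has the required cores.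
The ideal is `Fin` or a copy of `Fin ⊕ P(ω)` according to whether `Tᶜ` is finite. -/

lemma mem_finIdeal {S : Set ℕ} : S ∈ finIdeal ↔ S.Finite := Iff.rfl

lemma mem_finSumPowerset {S : Set (Fin 2 × ℕ)} :
    S ∈ finSumPowerset ↔ (S ∩ ({0} ×ˢ Set.univ)).Finite := Iff.rfl

lemma mem_core {I : Order.Ideal (Set ℕ)} {x : ℕ → ℝ} {c : ℝ} :
    c ∈ core I x ↔ ∀ S : Set ℕ, Sᶜ ∈ I → c ∈ closure (convexHull ℝ (x '' S)) := by
  simp [core]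

/-! ### Cores -/

lemma one_mem_core_indicator {I : Order.Ideal (Set ℕ)} {E : Set ℕ} (hE : E ∉ I) :
    (1 : ℝ) ∈ core I (E.indicator 1) := by
  refine mem_core.2 fun S hS => subset_closure (subset_convexHull ℝ _ ?_)
  by_contra h
  refine hE (I.lower (fun k hk hkS => h ⟨k, hkS, ?_⟩ : E ≤ Sᶜ) hS)
  simp [hk]

lemma core_indicator_subset {I : Order.Ideal (Set ℕ)} {E : Set ℕ} (hE : E ∈ I) :
    core I (E.indicator (1 : ℕ → ℝ)) ⊆ {0} := by
  intro c hc
  have h := mem_core.1 hc Eᶜ (by rwa [compl_compl])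
  have hsub : (E.indicator (1 : ℕ → ℝ)) '' Eᶜ ⊆ {0} := by
    rintro _ ⟨k, hk, rfl⟩
    exact Set.indicator_of_notMem hk _
  exact closure_minimal (convexHull_min hsub (convex_singleton 0)) isClosed_singleton h

lemma frequently_gt_of_mem_core {y : ℕ → ℝ} {c d : ℝ} (hc : c ∈ core finIdeal y) (hd : d < c) :
    ∃ᶠ n in atTop, d < y n := by
  intro h
  obtain ⟨N, hN⟩ := eventually_atTop.1 h
  have hfin : (Set.Ici N)ᶜ ∈ finIdeal := by
    rw [mem_finIdeal, Set.compl_Ici]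
    exact Set.finite_Iio N
  have hsub : y '' Set.Ici N ⊆ Set.Iic d := by
    rintro _ ⟨n, hn, rfl⟩
    exact not_lt.1 (hN n hn)
  have := closure_minimal (convexHull_min hsub (convex_Iic d)) isClosed_Iic
    (mem_core.1 hc _ hfin)
  exact absurd hd (not_lt.2 this)

lemma mem_core_of_mapClusterPt {y : ℕ → ℝ} {c : ℝ} (h : MapClusterPt c atTop y) :
    c ∈ core finIdeal y := by
  refine mem_core.2 fun S hS => closure_mono (subset_convexHull ℝ _) ?_
  have hS' : ∀ᶠ n in atTop, n ∈ S := by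
    rw [← Nat.cofinite_eq_atTop]
    exact mem_finIdeal.1 hS
  refine mem_closure_iff_nhds.2 fun U hU => ?_
  obtain ⟨n, hn, hnS⟩ := ((mapClusterPt_iff_frequently.1 h U hU).and_eventually hS').exists
  exact ⟨y n, hn, n, hnS, rfl⟩

/-- Every cluster point lies in the core, and a bounded sequence with a single cluster point
converges by compactness. -/
lemma tendsto_of_core_subset {y : ℕ → ℝ} (hy : y ∈ ellInfty) {c : ℝ}
    (h : core finIdeal y ⊆ {c}) : Tendsto y atTop (𝓝 c) := by
  obtain ⟨C, hC⟩ := hy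
  refine (isCompact_Icc (a := -C) (b := C)).tendsto_nhds_of_unique_mapClusterPt
    (Eventually.of_forall fun n => abs_le.1 (hC n)) fun z _ hz => h (mem_core_of_mapClusterPt hz)

/-! ### Matrices on bounded sequences -/

lemma indicator_mem_ellInfty (E : Set ℕ) : E.indicator (1 : ℕ → ℝ) ∈ ellInfty := by
  refine ⟨1, fun n => ?_⟩
  by_cases h : n ∈ E <;> simp [h]

/-- Testing against the signs of row `n` turns its partial sums into those of `|A n k|`. -/
lemma summable_abs_of_ellInfty_subset_dom {A : Matrix ℕ ℕ ℝ} (hA : ellInfty ⊆ dom A) (n : ℕ) :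
    Summable fun k => |A n k| := by
  have hx : (fun k => ((SignType.sign (A n k) : SignType) : ℝ)) ∈ ellInfty := by
    refine ⟨1, fun k => ?_⟩
    rcases lt_trichotomy (A n k) 0 with h | h | h <;> simp [h]
  obtain ⟨y, hy⟩ := hA hx n
  refine ((hasSum_iff_tendsto_nat_of_nonneg (fun k => abs_nonneg (A n k)) y).2 ?_).summable
  simpa only [self_mul_sign] using hy

lemma transform_indicator {A : Matrix ℕ ℕ ℝ} {n : ℕ} (hA : Summable fun k => |A n k|)
    (E : Set ℕ) : transform A (E.indicator 1) n = ∑' k, E.indicator (A n) k := by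
  have hs : Summable (E.indicator (A n)) := hA.of_abs.indicator E
  have : (fun k => A n k * E.indicator (1 : ℕ → ℝ) k) = E.indicator (A n) := by
    ext k
    by_cases h : k ∈ E <;> simp [h]
  simp only [transform]
  refine Tendsto.limUnder_eq ?_
  convert hs.hasSum.tendsto_sum_nat using 4 with N k
  exact congrFun this _

/-! ### The sliding hump -/

lemma sum_eq_tsum_indicator (a : ℕ → ℝ) (F : Finset ℕ) :
    ∑ k ∈ F, a k = ∑' k, (F : Set ℕ).indicator a k :=
  Finset.tsum_subtype' F a ▸ tsum_subtype (F : Set ℕ) a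

lemma abs_tsum_indicator_le {a : ℕ → ℝ} (ha : Summable fun k => |a k|) {F : Finset ℕ} {K : ℕ}
    {D : Set ℕ} (hD : ∀ k ∈ D, k ∈ F ∨ K ≤ k) :
    |∑' k, D.indicator a k| ≤ ∑ k ∈ F, |a k| + ∑' k, |a (k + K)| := by
  have hs : Summable fun k => |D.indicator a k| := (ha.of_abs.indicator D).abs
  have hF : Summable fun k => (F : Set ℕ).indicator (fun k => |a k|) k := ha.indicator _
  have hK : Summable fun k => (Set.Ici K).indicator (fun k => |a k|) k := ha.indicator _
  have h1 : |∑' k, D.indicator a k| ≤ ∑' k, |D.indicator a k| := by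
    simpa only [Real.norm_eq_abs] using norm_tsum_le_tsum_norm (f := D.indicator a) hs
  have h2 : ∑' k, |D.indicator a k| ≤ ∑' k, ((F : Set ℕ).indicator (fun k => |a k|) k
      + (Set.Ici K).indicator (fun k => |a k|) k) := by
    refine hs.tsum_le_tsum (fun k => ?_) (hF.add hK)
    have p1 : 0 ≤ (F : Set ℕ).indicator (fun k => |a k|) k :=
      Set.indicator_nonneg (fun k _ => abs_nonneg (a k)) k
    have p2 : 0 ≤ (Set.Ici K).indicator (fun k => |a k|) k :=
      Set.indicator_nonneg (fun k _ => abs_nonneg (a k)) k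
    by_cases h : k ∈ D
    · rcases hD k h with h' | h'
      · have : (F : Set ℕ).indicator (fun k => |a k|) k = |a k| :=
          Set.indicator_of_mem (Finset.mem_coe.2 h') _
        rw [Set.indicator_of_mem h]; linarith
      · have : (Set.Ici K).indicator (fun k => |a k|) k = |a k| :=
          Set.indicator_of_mem (Set.mem_Ici.2 h') _
        rw [Set.indicator_of_mem h]; linarith
    · rw [Set.indicator_of_notMem h, abs_zero]; positivity
  have h3 : ∑' k, (F : Set ℕ).indicator (fun k => |a k|) k = ∑ k ∈ F, |a k| :=
    (sum_eq_tsum_indicator _ F).symm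
  have h4 : ∑' k, (Set.Ici K).indicator (fun k => |a k|) k = ∑' k, |a (k + K)| := by
    rw [← hK.sum_add_tsum_nat_add K, Finset.sum_eq_zero, zero_add]
    · exact tsum_congr fun k => Set.indicator_of_mem (by simp) _
    · intro k hk
      exact Set.indicator_of_notMem (by simpa using hk) _
  rw [hF.tsum_add hK, h3, h4] at h2
  exact h1.trans h2

lemma exists_row_tails_lt (A : Matrix ℕ ℕ ℝ) {ε : ℝ} (hε : 0 < ε) (N : ℕ) : ∃ K, ∀ n < N, ∑' k, |A n (k + K)| < ε := by
  have : ∀ᶠ K in atTop, ∀ n ∈ Finset.range N, ∑' k, |A n (k + K)| < ε :=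
    (Finset.eventually_all _).2 fun n _ =>
      -- No summability is needed: the tails of a non-summable row all have `tsum` equal to `0` by
      -- convention.
      (tendsto_sum_nat_add fun k => |A n k|).eventually_lt_const hε
  obtain ⟨K, hK⟩ := eventually_atTop.1 this
  exact ⟨K, fun n hn => hK K le_rfl n (Finset.mem_range.2 hn)⟩

lemma exists_forall_sum_abs_lt {A : Matrix ℕ ℕ ℝ}
    (hcol : ∀ k, Tendsto (fun n => A n k) atTop (𝓝 0)) {ε : ℝ} (hε : 0 < ε) (F : Finset ℕ) :
    ∃ N, ∀ n ≥ N, ∑ k ∈ F, |A n k| < ε := by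
  have : Tendsto (fun n => ∑ k ∈ F, |A n k|) atTop (𝓝 0) := by
    simpa using tendsto_finsetSum F fun k _ => (hcol k).abs
  exact eventually_atTop.1 (this.eventually_lt_const hε)

/-- A gliding hump: finite sets chosen far enough out can be united so that each late row of the
matrix sees only one of them, up to `ε`. -/
lemma exists_gliding_hump {A : Matrix ℕ ℕ ℝ} (hA : ∀ n, Summable fun k => |A n k|)
    (hcol : ∀ k, Tendsto (fun n => A n k) atTop (𝓝 0)) {ε : ℝ} (hε : 0 < ε)
    {Q : ℕ → Finset ℕ → Prop} (hQ : ∀ N K, ∃ G : Finset ℕ, (∀ k ∈ G, K ≤ k) ∧ Q N G) :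
    ∃ (N : ℕ → ℕ) (G : ℕ → Finset ℕ), StrictMono N ∧ (∀ j, Q (N j) (G j)) ∧
      (∀ j, ∀ n ≥ N (j + 1), ∑ k ∈ G j, |A n k| < ε) ∧
      ∀ j n, N j ≤ n → n < N (j + 1) →
        |∑' k, (⋃ i, (G i : Set ℕ)).indicator (A n) k - ∑ k ∈ G j, A n k| ≤ ε := by
  have hε2 : 0 < ε / 2 := half_pos hε
  choose R hR using fun F => exists_forall_sum_abs_lt hcol hε2 F
  choose L hL using fun N => exists_row_tails_lt A hε2 N
  choose H hHL hHQ using hQ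
  -- a state is a pair: a row index and the union of the sets chosen so far
  let step : ℕ × Finset ℕ → Finset ℕ := fun s => H s.1 ((Finset.range (s.1 + 1)).sup L)
  let next : ℕ × Finset ℕ → ℕ × Finset ℕ :=
    -- From the new row index on, all sets chosen so far, the new one included, contribute less than
    -- `ε / 2`.
    fun s => (max (s.1 + 1) (R (s.2 ∪ step s)), s.2 ∪ step s)
  let s : ℕ → ℕ × Finset ℕ := fun j => next^[j] (0, ∅)
  have hs : ∀ j, s (j + 1) = next (s j) := fun j => Function.iterate_succ_apply' _ _ _
  have hs1 : ∀ j, (s (j + 1)).1 = max ((s j).1 + 1) (R (s (j + 1)).2) := fun j => by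
    rw [hs]
  have hs2 : ∀ j, (s (j + 1)).2 = (s j).2 ∪ step (s j) := fun j => by rw [hs]
  have hN : StrictMono fun j => (s j).1 := strictMono_nat_of_lt_succ fun j => by
    show (s j).1 < (s (j + 1)).1
    rw [hs1]
    exact lt_of_lt_of_le (Nat.lt_succ_self _) (le_max_left _ _)
  have hF : Monotone fun j => (s j).2 := monotone_nat_of_le_succ fun j => by
    show (s j).2 ≤ (s (j + 1)).2
    rw [hs2]
    exact Finset.subset_union_left
  have hsub : ∀ j, step (s j) ⊆ (s (j + 1)).2 := fun j => by
    rw [hs2]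
    exact Finset.subset_union_right
  have hsmall : ∀ j, ∀ n ≥ (s j).1, ∑ k ∈ (s j).2, |A n k| < ε / 2 := by
    intro j n hn
    cases j with
    | zero => simpa [s] using hε2
    | succ j =>
      refine hR _ n (le_trans ?_ hn)
      rw [hs1]
      exact le_max_right _ _
  refine ⟨fun j => (s j).1, fun j => step (s j), hN, fun j => hHQ _ _, fun j n hn => ?_,
    fun j n hjn hnj => ?_⟩
  · refine lt_of_le_of_lt (Finset.sum_le_sum_of_subset_of_nonneg (hsub j)
      fun k _ _ => abs_nonneg _) ((hsmall (j + 1) n hn).trans (half_lt_self hε))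
  · set E : Set ℕ := ⋃ i, (step (s i) : Set ℕ)
    have hjE : (step (s j) : Set ℕ) ⊆ E := Set.subset_iUnion (fun i => (step (s i) : Set ℕ)) j
    have hdiff : ∑' k, E.indicator (A n) k - ∑ k ∈ step (s j), A n k
        = ∑' k, (E \ step (s j)).indicator (A n) k := by
      rw [sum_eq_tsum_indicator, ← ((hA n).of_abs.indicator _).tsum_sub ((hA n).of_abs.indicator _)]
      refine tsum_congr fun k => ?_
      rw [Set.indicator_sdiff hjE]
      rfl
    rw [hdiff]
    -- Earlier sets lie in `(s j).2`, later ones beyond `L (s (j + 1)).1`; each group costs at most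
    -- `ε / 2` in row `n`.
    refine (abs_tsum_indicator_le (hA n) (F := (s j).2) (K := L (s (j + 1)).1)
      fun k hk => ?_).trans ?_
    · obtain ⟨hkE, hkj⟩ := hk
      obtain ⟨i, hi⟩ := Set.mem_iUnion.1 hkE
      rcases lt_trichotomy i j with h | h | h
      · exact Or.inl (hF (Nat.succ_le_of_lt h) (hsub i hi))
      · exact absurd (h ▸ hi) hkj
      · refine Or.inr (le_trans ?_ (hHL _ _ k hi))
        refine Finset.le_sup (f := L) (Finset.mem_range.2 (Nat.lt_succ_of_le ?_))
        exact hN.monotone (Nat.succ_le_of_lt h)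
    · have h1 := hsmall j n hjn
      have h2 := hL (s (j + 1)).1 n hnj
      linarith

/-! ### The ideals represented by matrices -/

/-- The matrix `A` takes the `I`-core of each indicator sequence to the ordinary core. -/
def RepresentsIndicators (A : Matrix ℕ ℕ ℝ) (I : Order.Ideal (Set ℕ)) : Prop :=
  ∀ E : Set ℕ, core finIdeal (transform A (E.indicator 1)) = core I (E.indicator 1)

section Representation

variable {A : Matrix ℕ ℕ ℝ} {I : Order.Ideal (Set ℕ)}

lemma tendsto_of_mem (hAm : A ∈ matrixClass ellInfty ellInfty)
    (hcore : RepresentsIndicators A I) {E : Set ℕ} (hE : E ∈ I) :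
    Tendsto (fun n => ∑' k, E.indicator (A n) k) atTop (𝓝 0) := by
  have h := tendsto_of_core_subset (hAm.2 _ (indicator_mem_ellInfty E))
    ((hcore E).trans_subset (core_indicator_subset hE))
  exact h.congr fun n => transform_indicator (summable_abs_of_ellInfty_subset_dom hAm.1 n) E

lemma frequently_gt_of_notMem (hAm : A ∈ matrixClass ellInfty ellInfty)
    (hcore : RepresentsIndicators A I) {E : Set ℕ} (hE : E ∉ I) {d : ℝ} (hd : d < 1) :
    ∃ᶠ n in atTop, d < ∑' k, E.indicator (A n) k := by
  have h := frequently_gt_of_mem_core ((hcore E).symm ▸ one_mem_core_indicator hE) hd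
  exact h.mono fun n hn =>
    transform_indicator (summable_abs_of_ellInfty_subset_dom hAm.1 n) E ▸ hn

lemma tendsto_column (hI : Admissible I) (hAm : A ∈ matrixClass ellInfty ellInfty)
    (hcore : RepresentsIndicators A I) (k : ℕ) : Tendsto (fun n => A n k) atTop (𝓝 0) := by
  have h := tendsto_of_mem hAm hcore (hI.finite_mem {k} (Set.finite_singleton k))
  refine h.congr fun n => ?_
  rw [tsum_eq_single k fun j hj => Set.indicator_of_notMem (by simpa using hj) _]
  simp

/-- If the matrix entries on `E` stay bounded by `1 / 2`, then `E` belongs to the ideal. -/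
lemma mem_of_entries_le_half (hI : Admissible I) (hAm : A ∈ matrixClass ellInfty ellInfty)
    (hcore : RepresentsIndicators A I) {E : Set ℕ} (hE : ∀ k ∈ E, ∀ n, A n k ≤ 1 / 2) :
    E ∈ I := by
  classical
  by_contra hEI
  have hA := summable_abs_of_ellInfty_subset_dom hAm.1
  have hcol := tendsto_column hI hAm hcore
  let Q : ℕ → Finset ℕ → Prop := fun N G =>
    (∃ n ≥ N, 1 / 4 ≤ ∑ k ∈ G, A n k) ∧ ∀ n ≥ N, ∑ k ∈ G, A n k ≤ 3 / 4
  have hQ : ∀ N K, ∃ G : Finset ℕ, (∀ k ∈ G, K ≤ k) ∧ Q N G := by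
    intro N K
    have hEK : E ∩ Set.Ici K ∉ I := fun h => hEI <| by
      refine I.lower (?_ : E ≤ (E ∩ Set.Ici K) ⊔ Set.Iio K)
        (I.sup_mem h (hI.finite_mem _ (Set.finite_Iio K)))
      intro k hk
      rcases lt_or_ge k K with h' | h'
      exacts [Or.inr h', Or.inl ⟨hk, h'⟩]
    obtain ⟨n, hn, hnN⟩ := ((frequently_gt_of_notMem hAm hcore hEK
      (show (1 / 4 : ℝ) < 1 by norm_num)).and_eventually (eventually_ge_atTop N)).exists
    let G : ℕ → Finset ℕ := fun m => (Finset.range m).filter (· ∈ E ∩ Set.Ici K)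
    have hGs : ∀ m n, ∑ k ∈ G m, A n k
        = ∑ k ∈ Finset.range m, (E ∩ Set.Ici K).indicator (A n) k := fun m n => by
      simp only [G, Finset.sum_filter, Set.indicator_apply]
    -- Stop at the least initial segment reaching `1 / 4` in some row `n ≥ N`. Before its last
    -- column all these rows are below `1 / 4`, and that column adds at most `1 / 2`, whence the
    -- bound `3 / 4`.
    have hex : ∃ m, ∃ n ≥ N, 1 / 4 ≤ ∑ k ∈ G m, A n k := by
      have ht := ((hA n).of_abs.indicator (E ∩ Set.Ici K)).hasSum.tendsto_sum_nat
      obtain ⟨m, hm⟩ := (ht.eventually_const_lt hn).exists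
      exact ⟨m, n, hnN, (hGs m n).symm ▸ hm.le⟩
    refine ⟨G (Nat.find hex), fun k hk => (Finset.mem_filter.1 hk).2.2, Nat.find_spec hex, ?_⟩
    intro n hn
    cases hm : Nat.find hex with
    | zero => norm_num [G]
    | succ m =>
      have hlt : ∑ k ∈ G m, A n k < 1 / 4 := by
        by_contra h
        exact Nat.find_min hex (hm ▸ Nat.lt_succ_self m) ⟨n, hn, not_lt.1 h⟩
      have hlast : (E ∩ Set.Ici K).indicator (A n) m ≤ 1 / 2 := by
        by_cases h : m ∈ E ∩ Set.Ici K
        · rw [Set.indicator_of_mem h]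
          exact hE m h.1 n
        · rw [Set.indicator_of_notMem h]
          norm_num
      rw [hGs] at hlt ⊢
      rw [Finset.sum_range_succ]
      linarith
  obtain ⟨N, G, hN, hQG, hsmall, hclose⟩ :=
    exists_gliding_hump hA hcol (show (0 : ℝ) < 1 / 8 by norm_num) hQ
  -- With error `1 / 8`, membership fails because of row sums at least `1 / 4 - 1 / 8`, and
  -- non-membership because all rows from `N 0` on stay below `3 / 4 + 1 / 8` or equal it.
  by_cases hU : (⋃ i, (G i : Set ℕ)) ∈ I
  · have hlim := tendsto_of_mem hAm hcore hU
    obtain ⟨M, hM⟩ := eventually_atTop.1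
      (hlim.eventually_lt_const (show (0 : ℝ) < 1 / 8 by norm_num))
    obtain ⟨n, hn, hge⟩ := (hQG M).1
    -- The row where block `M` is large belongs to its own window, since the block is negligible
    -- from `N (M + 1)` on.
    have hn' : n < N (M + 1) := by
      by_contra h
      have := (Finset.abs_sum_le_sum_abs _ _).trans_lt (hsmall M n (not_lt.1 h))
      linarith [(abs_lt.1 this).2]
    have := (abs_le.1 (hclose M n hn hn')).1
    linarith [hM n ((hN.id_le M).trans hn)]
  · obtain ⟨n, hn, hnN⟩ := ((frequently_gt_of_notMem hAm hcore hU
      (show (7 / 8 : ℝ) < 1 by norm_num)).and_eventually (eventually_ge_atTop (N 0))).exists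
    obtain ⟨j, hj, hj'⟩ : ∃ j, N j ≤ n ∧ n < N (j + 1) := by
      have hex : ∃ m, n < N m := ⟨n + 1, hN.id_le (n + 1)⟩
      cases hm : Nat.find hex with
      | zero => exact absurd (hm ▸ Nat.find_spec hex) (not_lt.2 hnN)
      | succ m =>
        exact ⟨m, not_lt.1 (Nat.find_min hex (hm ▸ Nat.lt_succ_self m)),
          hm ▸ Nat.find_spec hex⟩
    have := (abs_le.1 (hclose j n hj hj')).2
    linarith [(hQG j).2 n hj]

/-- If infinitely many columns meeting `E` have an entry above `1 / 2`, then `E` is not in the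
ideal. -/
lemma notMem_of_infinite (hI : Admissible I) (hAm : A ∈ matrixClass ellInfty ellInfty)
    (hcore : RepresentsIndicators A I) {E : Set ℕ} (hinf : E.Infinite)
    (hE : ∀ k ∈ E, ∃ n, 1 / 2 < A n k) : E ∉ I := by
  intro hEI
  have hA := summable_abs_of_ellInfty_subset_dom hAm.1
  have hcol := tendsto_column hI hAm hcore
  let Q : ℕ → Finset ℕ → Prop := fun N G =>
    (G : Set ℕ) ⊆ E ∧ ∃ n ≥ N, 1 / 2 < ∑ k ∈ G, A n k
  have hQ : ∀ N K, ∃ G : Finset ℕ, (∀ k ∈ G, K ≤ k) ∧ Q N G := by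
    intro N K
    -- Rows tend to `0`, so for a late column an entry above `1 / 2` can only occur in a row `n ≥
    -- N`.
    have hrow : ∀ᶠ k in atTop, ∀ n ∈ Finset.range N, A n k < 1 / 2 :=
      (Finset.eventually_all _).2 fun n _ =>
        ((hA n).of_abs.tendsto_atTop_zero).eventually_lt_const (by norm_num)
    obtain ⟨k, hkE, hk, hkK⟩ := ((Nat.frequently_atTop_iff_infinite.2 hinf).and_eventually
      (hrow.and (eventually_ge_atTop K))).exists
    obtain ⟨n, hn⟩ := hE k hkE
    refine ⟨{k}, by simpa using hkK, by rwa [Finset.coe_singleton, Set.singleton_subset_iff], n, ?_, by simpa using hn⟩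
    by_contra h
    exact lt_asymm hn (hk n (Finset.mem_range.2 (not_le.1 h)))
  obtain ⟨N, G, hN, hQG, hsmall, hclose⟩ :=
    exists_gliding_hump hA hcol (show (0 : ℝ) < 1 / 4 by norm_num) hQ
  have hU : (⋃ i, (G i : Set ℕ)) ∈ I := I.lower (Set.iUnion_subset fun i => (hQG i).1) hEI
  have hlim := tendsto_of_mem hAm hcore hU
  obtain ⟨M, hM⟩ := eventually_atTop.1
    (hlim.eventually_lt_const (show (0 : ℝ) < 1 / 8 by norm_num))
  obtain ⟨n, hn, hge⟩ := (hQG M).2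
  have hn' : n < N (M + 1) := by
    by_contra h
    have := (Finset.abs_sum_le_sum_abs _ _).trans_lt (hsmall M n (not_lt.1 h))
    linarith [(abs_lt.1 this).2]
  have := (abs_le.1 (hclose M n hn hn')).1
  linarith [hM n ((hN.id_le M).trans hn)]

lemma exists_support_of_represents (hI : Admissible I)
    (hAm : A ∈ matrixClass ellInfty ellInfty) (hcore : RepresentsIndicators A I) :
    ∃ T : Set ℕ, T.Infinite ∧ ∀ S : Set ℕ, S ∈ I ↔ (S ∩ T).Finite := by
  let T : Set ℕ := {k | ∃ n, 1 / 2 < A n k}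
  have hT : ∀ S : Set ℕ, S ∈ I ↔ (S ∩ T).Finite := by
    intro S
    constructor
    · intro hS
      by_contra h
      exact notMem_of_infinite hI hAm hcore h (fun k hk => hk.2)
        (I.lower (Set.inter_subset_left : S ∩ T ⊆ S) hS)
    · intro h
      have h' : S \ T ∈ I := mem_of_entries_le_half hI hAm hcore fun k hk n =>
        not_lt.1 fun hlt => hk.2 ⟨n, hlt⟩
      refine I.lower (?_ : S ≤ (S ∩ T) ⊔ (S \ T)) (I.sup_mem (hI.finite_mem _ h) h')
      exact (Set.inter_union_sdiff S T).ge
  refine ⟨T, fun h => hI.univ_notMem ((hT _).2 ?_), hT⟩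
  rwa [Set.univ_inter]

end Representation

/-! ### Selection matrices -/

/-- The matrix of the map `x ↦ x ∘ t`. -/
def selectionMatrix (t : ℕ → ℕ) : Matrix ℕ ℕ ℝ := fun n k => if k = t n then 1 else 0

lemma tendsto_selectionMatrix (t : ℕ → ℕ) (x : ℕ → ℝ) (n : ℕ) :
    Tendsto (fun N => ∑ k ∈ Finset.range N, selectionMatrix t n k * x k) atTop
      (𝓝 (x (t n))) := by
  refine tendsto_const_nhds.congr' ?_
  filter_upwards [eventually_gt_atTop (t n)] with N hN
  simp [selectionMatrix, hN]

lemma transform_selectionMatrix (t : ℕ → ℕ) (x : ℕ → ℝ) :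
    transform (selectionMatrix t) x = x ∘ t :=
  funext fun n => (tendsto_selectionMatrix t x n).limUnder_eq

lemma selectionMatrix_mem (t : ℕ → ℕ) : selectionMatrix t ∈ matrixClass ellInfty ellInfty := by
  refine ⟨fun x _ n => ⟨_, tendsto_selectionMatrix t x n⟩, ?_⟩
  rintro x ⟨C, hC⟩
  rw [transform_selectionMatrix]
  exact ⟨C, fun n => hC (t n)⟩

/-- Preimages under `t` send the dual filter of `I` to cofinite sets, by injectivity; images of
cofinite sets lie in that filter, since their complements meet the range of `t` finitely. -/
lemma core_comp {I : Order.Ideal (Set ℕ)} {t : ℕ → ℕ} (ht : Function.Injective t)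
    (hI : ∀ S : Set ℕ, S ∈ I ↔ (S ∩ Set.range t).Finite) (x : ℕ → ℝ) :
    core finIdeal (x ∘ t) = core I x := by
  ext c
  rw [mem_core, mem_core]
  constructor
  · intro h S hS
    have hfin : (t ⁻¹' S)ᶜ ∈ finIdeal := by
      rw [mem_finIdeal, ← Set.preimage_compl, ← Set.preimage_inter_range]
      exact ((hI _).1 hS).preimage ht.injOn
    refine closure_mono (convexHull_mono ?_) (h _ hfin)
    rw [Set.image_comp]
    exact Set.image_mono (Set.image_preimage_subset t S)
  · intro h S hS
    rw [Set.image_comp]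
    refine h _ ((hI _).2 (((mem_finIdeal.1 hS).image t).subset ?_))
    rintro _ ⟨hk, n, rfl⟩
    exact ⟨n, fun hn => hk ⟨n, hn, rfl⟩, rfl⟩

lemma exists_matrix_of_support {I : Order.Ideal (Set ℕ)} {T : Set ℕ} (hT : T.Infinite)
    (hI : ∀ S : Set ℕ, S ∈ I ↔ (S ∩ T).Finite) :
    ∃ A ∈ matrixClass ellInfty ellInfty,
      ∀ x ∈ ellInfty, core finIdeal (transform A x) = core I x := by
  refine ⟨selectionMatrix (Nat.nth (· ∈ T)), selectionMatrix_mem _, fun x _ => ?_⟩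
  rw [transform_selectionMatrix]
  refine core_comp (t := Nat.nth (· ∈ T)) (Nat.nth_injective hT) (fun S => ?_) x
  have hrange : Set.range (Nat.nth (· ∈ T)) = T := Nat.range_nth_of_infinite hT
  rw [hrange, hI]

/-! ### Isomorphic copies of `Fin ⊕ P(ω)` -/

lemma exists_equiv_of_infinite_compl {T : Set ℕ} (hT : T.Infinite) (hTc : Tᶜ.Infinite) :
    ∃ f : ℕ ≃ Fin 2 × ℕ, ∀ k, (f k).1 = 0 ↔ k ∈ T := by
  classical
  have := hT.to_subtype
  have := hTc.to_subtype
  obtain ⟨g⟩ : Nonempty (T ≃ ℕ) := nonempty_equiv_of_countable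
  obtain ⟨h⟩ : Nonempty ((Tᶜ : Set ℕ) ≃ ℕ) := nonempty_equiv_of_countable
  refine ⟨(Equiv.Set.sumCompl T).symm.trans ((Equiv.sumCongr g h).trans
    ((Equiv.boolProdEquivSum ℕ).symm.trans (finTwoEquiv.symm.prodCongr (Equiv.refl ℕ)))),
    fun k => ?_⟩
  by_cases hk : k ∈ T
  · simp [Equiv.Set.sumCompl_symm_apply_of_mem hk, hk, finTwoEquiv]
  · simp [Equiv.Set.sumCompl_symm_apply_of_notMem hk, hk, finTwoEquiv]

lemma isIsomorphicCopy_of_support {I : Order.Ideal (Set ℕ)} {T : Set ℕ} (hT : T.Infinite)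
    (hTc : Tᶜ.Infinite) (hI : ∀ S : Set ℕ, S ∈ I ↔ (S ∩ T).Finite) :
    IsIsomorphicCopy I finSumPowerset := by
  obtain ⟨f, hf⟩ := exists_equiv_of_infinite_compl hT hTc
  refine ⟨f, fun S => ?_⟩
  have : f ⁻¹' S ∩ T = f ⁻¹' (S ∩ ({0} ×ˢ Set.univ)) := by
    ext k
    simp [hf]
  rw [hI, this, mem_finSumPowerset]
  exact ⟨fun h => h.preimage f.injective.injOn, fun h => h.of_preimage f.surjective⟩

lemma exists_support_iff {I : Order.Ideal (Set ℕ)} :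
    (I = finIdeal ∨ IsIsomorphicCopy I finSumPowerset) ↔
      ∃ T : Set ℕ, T.Infinite ∧ ∀ S : Set ℕ, S ∈ I ↔ (S ∩ T).Finite := by
  constructor
  · rintro (rfl | ⟨f, hf⟩)
    · exact ⟨Set.univ, Set.infinite_univ, fun S => by rw [Set.inter_univ, mem_finIdeal]⟩
    · refine ⟨f ⁻¹' ({0} ×ˢ Set.univ), ?_, fun S => ?_⟩
      · refine Set.Infinite.preimage ?_ (by simp)
        exact Set.infinite_univ.prod_right (Set.singleton_nonempty 0)
      · have h := hf (f '' S)
        rw [Set.preimage_image_eq _ f.injective] at h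
        rw [← h, mem_finSumPowerset, ← Set.image_inter_preimage]
        exact Set.finite_image_iff f.injective.injOn
  · rintro ⟨T, hT, hI⟩
    by_cases hTc : Tᶜ.Finite
    · refine Or.inl (SetLike.ext fun S => ?_)
      rw [hI, mem_finIdeal]
      refine ⟨fun h => (h.union hTc).subset fun k hk => ?_, fun h => h.subset Set.inter_subset_left⟩
      by_cases hkT : k ∈ T
      exacts [Or.inl ⟨hk, hkT⟩, Or.inr hkT]
    · exact Or.inr (isIsomorphicCopy_of_support hT hTc hI)

end IdealCore

theorem theorem2p5 (I : Order.Ideal (Set ℕ)) (hI : Admissible I) :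
    ((∃ A ∈ matrixClass ellInfty ellInfty,
        ∀ x ∈ ellInfty, core finIdeal (transform A x) = core I x) ↔
      (I = finIdeal ∨ IsIsomorphicCopy I finSumPowerset)) ∧
    ((I = finIdeal ∨ IsIsomorphicCopy I finSumPowerset) ↔
      ∃ T : Set ℕ, T.Infinite ∧ ∀ S : Set ℕ, S ∈ I ↔ (S ∩ T).Finite) := by
  refine ⟨?_, exists_support_iff⟩
  rw [exists_support_iff]
  constructor
  · rintro ⟨A, hA, hcore⟩
    exact exists_support_of_represents hI hA fun E => hcore _ (indicator_mem_ellInfty E)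
  · rintro ⟨T, hT, hIT⟩
    exact exists_matrix_of_support hT hIT
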